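/- Let $\mathcal G$ be a connected reductive linear algebraic group over $\mathbb Q$, $\mathbb A=\mathbb R\times\mathbb A_{\rm fin}$ the adeles of $\mathbb Q$, and $G=\mathcal G(\mathbb R)$. For a linear algebraic $\mathbb Q$-group $\mathcal S$ and $E=\mathbb R$ or $\mathbb A$ let $\mathcal S(E)^1$ be the group of all $g\in\mathcal S(E)$ with $|\chi(g)|=1$ for all rational characters $\chi$ of $\mathcal S$ defined over $\mathbb Q$; write $P^1=\mathcal P(\mathbb R)^1$ and $G^1=\mathcal G(\mathbb R)^1$. Fix a minimal parabolic $\mathbb Q$-subgroup $\mathcal P_0$ of $\mathcal G$ with unipotent radical $\mathcal N_0$ and Levi component $\mathcal L_0$, and a compact subgroup $\mathbf K$ of $\mathcal G(\mathbb A)$ with $\mathcal G(\mathbb A)=\mathcal N_0(\mathbb A)\mathcal L_0(\mathbb A)\mathbf K$. Let $X(\mathcal L_0)$ be the group of rational characters of $\mathcal L_0$ over $\mathbb Q$, $\mathfrak a_0=\mathrm{Hom}(X(\mathcal L_0),\mathbb R)$, let $H:\mathcal G(\mathbb A)\to\mathfrak a_0$ be given by $\langle H(umk),\chi\rangle=\log|\chi(m)|$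 for $u\in\mathcal N_0(\mathbb A)$, $m\in\mathcal L_0(\mathbb A)$, $k\in\mathbf K$, and let $T\in\mathfrak a_0$. A parabolic $\mathbb Q$-subgroup $\mathcal P$ is standard if it contains $\mathcal P_0$; then $\mathcal N$ is its unipotent radical, $\mathcal L$ its Levi component containing $\mathcal L_0$, $\mathcal A_{\mathcal P}$ the largest $\mathbb Q$-split torus in the centre of $\mathcal L$, and $\hat\tau_{\mathcal P}$ is the characteristic function of the set of all $h\in\mathfrak a_0$ at which $\varpi_\alpha(h)>0$ for each simple root $\alpha$ of $(\mathcal P_0,\mathcal A_{\mathcal P_0})$ that is not a root of $\mathcal L$, where $\varpi_\alpha$ is the fundamental weight of $\alpha$. In particular $\hat\tau_{\mathcal G}=1$. Fix Haar measures on the groups $\mathcal N(\mathbb A)$ and on $\mathcal G(\mathbb A)^1$. Let $\mathfrak o$ be a class in $\mathcal G(\mathbb Q)$ for the equivalence relation under which two elements are equivalent if the semisimple components of their Jordan decompositions are conjugate in $\mathcal G(\mathbb Q)$. For $f\in C_c^\infty(\mathcal G(\mathbb A)^1)$ put $$K_{\mathcal P,\mathfrak o}(x,y)=\sum_{\gamma\in\mathcal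 L(\mathbb Q)\cap\mathfrak o}\int_{\mathcal N(\mathbb A)}f(x^{-1}\gamma ny)\,dn,$$ $$k_{\mathfrak o}(x)=\sum_{\mathcal P\text{ standard}}(-1)^{\dim\mathcal A_{\mathcal P}/\mathcal A_{\mathcal G}}\sum_{\delta\in\mathcal P(\mathbb Q)\backslash\mathcal G(\mathbb Q)}K_{\mathcal P,\mathfrak o}(\delta x,\delta x)\,\hat\tau_{\mathcal P}(H(\delta x)-T),$$ $$J_{\mathfrak o}(f)=\int_{\mathcal G(\mathbb Q)\backslash\mathcal G(\mathbb A)^1}k_{\mathfrak o}(x)\,dx.$$ An element of $\mathcal G(\mathbb Q)$ is called $\mathbb Q$-elliptic if it lies in no parabolic $\mathbb Q$-subgroup other than $\mathcal G$, and $\mathfrak o$ is called $\mathbb Q$-elliptic if it contains a $\mathbb Q$-elliptic element. The function $f$ is called parabolically regular at the infinite place if, for some compact open subgroup $K_{\rm fin}$ of $\mathcal G(\mathbb A_{\rm fin})$, it is supported on $K_{\rm fin}\times G^1$ and vanishes on all $G$-conjugates of $K_{\rm fin}\times P^1$ for every parabolic $\mathbb Q$-subgroup $\mathcal P\ne\mathcal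 G$. Suppose that $f\in C_c^\infty(\mathcal G(\mathbb A)^1)$ is parabolically regular at the infinite place. If $\mathfrak o$ is not $\mathbb Q$-elliptic, then $k_{\mathfrak o}$ is integrable over $\mathcal G(\mathbb Q)\backslash\mathcal G(\mathbb A)^1$ and $J_{\mathfrak o}(f)=0$. If $\mathfrak o$ is $\mathbb Q$-elliptic, then $k_{\mathfrak o}(x)$ is integrable over $\mathcal G(\mathbb Q)\backslash\mathcal G(\mathbb A)^1$ if and only if $K_{\mathcal G,\mathfrak o}(x,x)$ is, and $$J_{\mathfrak o}(f)=\int_{\mathcal G(\mathbb Q)\backslash\mathcal G(\mathbb A)^1}K_{\mathcal G,\mathfrak o}(x,x)\,dx$$ (integrals of non-integrable functions being read as $0$). -/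

import Mathlib

open NumberField MeasureTheory Topology Filter
open scoped ContDiff Matrix.GeneralLinearGroup

noncomputable section

namespace SimpleTrace

/-! ### The adeles of `ℚ` -/

/-- A fixed algebraic closure of `ℚ`. -/
abbrev Qbar : Type := AlgebraicClosure ℚ

/-- The finite adeles of `ℚ`. -/
abbrev AFin : Type := IsDedekindDomain.FiniteAdeleRing (𝓞 ℚ) ℚ

/-- The adeles of `ℚ`, as the product of `ℝ` and the finite adeles. -/
abbrev Adele : Type := ℝ × AFin

/-- The finite places of `ℚ`. -/
abbrev FinPlace : Type := IsDedekindDomain.HeightOneSpectrum (𝓞 ℚ)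

theorem finite_mulSupport_norm (u : AFinˣ) :
    (Function.mulSupport fun v : FinPlace => ‖(u : AFin) v‖).Finite := by
  have h := (IsDedekindDomain.FiniteAdeleRing.isUnit_iff.1 u.isUnit).2
  refine Set.Finite.subset (Filter.eventually_cofinite.1 h) fun v hv hv' => hv ?_
  simp [FinitePlace.norm_def, hv']

/-- The absolute value `∏_p |u_p|_p` of a finite idele, each `|·|_p` being normalized. -/
def finNorm : AFinˣ →* ℝ where
  toFun u := ∏ᶠ v : FinPlace, ‖(u : AFin) v‖
  map_one' := finprod_eq_one_of_forall_eq_one fun v => norm_one (α := v.adicCompletion ℚ)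
  map_mul' u w := by
    rw [← finprod_mul_distrib (finite_mulSupport_norm u) (finite_mulSupport_norm w)]
    exact finprod_congr fun v => norm_mul (α := v.adicCompletion ℚ) _ _

/-- The idelic absolute value `|u| = |u_∞| ∏_p |u_p|_p`. -/
def ideleNorm : Adeleˣ →* ℝ where
  toFun u := |(u : Adele).1| * finNorm (Units.map (RingHom.snd ℝ AFin).toMonoidHom u)
  map_one' := by simp
  map_mul' u w := by
    rw [map_mul, map_mul, Units.val_mul, Prod.fst_mul, abs_mul]
    ring

theorem ideleNorm_ne_zero (u : Adeleˣ) : ideleNorm u ≠ 0 :=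
  ((Group.isUnit u).map ideleNorm).ne_zero

/-! ### Linear algebraic groups over `ℚ` -/

/-- Polynomials with coefficients in `k` in the entries of a matrix `g` and of `g⁻¹`; they induce
all regular functions on `GL n`. -/
abbrev RegFun (k : Type) [CommRing k] (n : ℕ) : Type :=
  MvPolynomial ((Fin n × Fin n) ⊕ (Fin n × Fin n)) k

/-- The value of a regular function at a point `g` of `GL n`. -/
def evalGL {k E : Type} [CommRing k] [CommRing E] [Algebra k E] {n : ℕ}
    (p : RegFun k n) (g : GL (Fin n) E) : E :=
  MvPolynomial.aeval
    (Sum.elim (fun ij => (g : Matrix (Fin n) (Fin n) E) ij.1 ij.2)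
      (fun ij => ((g⁻¹ : GL (Fin n) E) : Matrix (Fin n) (Fin n) E) ij.1 ij.2)) p

/-- A linear algebraic group over `ℚ`: a Zariski closed subgroup of `GL n` defined over `ℚ`,
given by its functor of points. The condition says that the `E`-points are the zeros in `GL n E`
of the ideal of all regular functions over `ℚ` which vanish on the `Qbar`-points. -/
@[ext]
structure QGroup (n : ℕ) where
  /-- The group of `E`-points. -/
  pts : ∀ (E : Type) [CommRing E] [Algebra ℚ E], Subgroup (GL (Fin n) E)
  mem_pts_iff : ∀ (E : Type) [CommRing E] [Algebra ℚ E] (g : GL (Fin n) E),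
    g ∈ pts E ↔ ∀ p : RegFun ℚ n, (∀ h ∈ pts Qbar, evalGL p h = 0) → evalGL p g = 0

/-- `S` is a subgroup of `T`. -/
instance {n : ℕ} : LE (QGroup n) where
  le S T := ∀ (E : Type) [CommRing E] [Algebra ℚ E], S.pts E ≤ T.pts E

/-- A rational character of `S` defined over `ℚ`, i.e. a homomorphism `S → GL 1` of algebraic
groups over `ℚ`. -/
@[ext]
structure RatChar {n : ℕ} (S : QGroup n) where
  app : ∀ (E : Type) [CommRing E] [Algebra ℚ E], S.pts E →* Eˣ
  regular : ∃ p : RegFun ℚ n, ∀ (E : Type) [CommRing E] [Algebra ℚ E] (g : S.pts E),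
    (app E g : E) = evalGL p (g : GL (Fin n) E)

namespace RatChar

variable {n : ℕ} {S : QGroup n}

instance : One (RatChar S) where
  one := ⟨fun _ _ _ => 1, 1, fun _ _ _ _ => by simp [evalGL]⟩

instance : Mul (RatChar S) where
  mul χ ψ := ⟨fun E _ _ => χ.app E * ψ.app E, by
    obtain ⟨p, hp⟩ := χ.regular
    obtain ⟨q, hq⟩ := ψ.regular
    exact ⟨p * q, fun E _ _ g => by simp [hp, hq, evalGL]⟩⟩

instance : Inv (RatChar S) where
  inv χ := ⟨fun E _ _ => (χ.app E)⁻¹, by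
    obtain ⟨p, hp⟩ := χ.regular
    refine ⟨MvPolynomial.rename Sum.swap p, fun E _ _ g => ?_⟩
    rw [MonoidHom.inv_apply, ← map_inv, hp]
    simp only [evalGL, MvPolynomial.aeval_rename]
    congr 2
    funext ij
    rcases ij with ij | ij <;> simp⟩

theorem one_app (E : Type) [CommRing E] [Algebra ℚ E] : (1 : RatChar S).app E = 1 := rfl

theorem mul_app (χ ψ : RatChar S) (E : Type) [CommRing E] [Algebra ℚ E] :
    (χ * ψ).app E = χ.app E * ψ.app E := rfl

theorem inv_app (χ : RatChar S) (E : Type) [CommRing E] [Algebra ℚ E] :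
    (χ⁻¹).app E = (χ.app E)⁻¹ := rfl

/-- The group of rational characters over `ℚ`, under pointwise multiplication. -/
instance : CommGroup (RatChar S) where
  mul_assoc a b c := by ext E; simp [mul_app, mul_assoc]
  one_mul a := by ext E; simp [mul_app, one_app]
  mul_one a := by ext E; simp [mul_app, one_app]
  inv_mul_cancel a := by ext E; simp [mul_app, one_app, inv_app]
  mul_comm a b := by ext E; simp [mul_app, mul_comm]

end RatChar

namespace QGroup

variable {n : ℕ}

/-- The points `S(𝔸)¹`: all rational characters over `ℚ` have absolute value `1`. -/
def adelicOne (S : QGroup n) : Subgroup (GL (Fin n) Adele) where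
  carrier := {g | ∃ h : g ∈ S.pts Adele, ∀ χ : RatChar S, ideleNorm (χ.app Adele ⟨g, h⟩) = 1}
  one_mem' := ⟨one_mem _, fun χ => by
    have : (⟨1, one_mem _⟩ : S.pts Adele) = 1 := rfl
    rw [this, map_one, map_one]⟩
  mul_mem' := by
    rintro a b ⟨ha, ha'⟩ ⟨hb, hb'⟩
    refine ⟨mul_mem ha hb, fun χ => ?_⟩
    have : (⟨a * b, mul_mem ha hb⟩ : S.pts Adele) = ⟨a, ha⟩ * ⟨b, hb⟩ := rfl
    rw [this, map_mul, map_mul, ha', hb', one_mul]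
  inv_mem' := by
    rintro a ⟨ha, ha'⟩
    refine ⟨inv_mem ha, fun χ => ?_⟩
    have h1 : ideleNorm (χ.app Adele (⟨a, ha⟩⁻¹ * ⟨a, ha⟩)) = 1 := by
      rw [inv_mul_cancel, map_one, map_one]
    rw [map_mul, map_mul, ha', mul_one] at h1
    exact h1

/-- The points `S(ℝ)¹`: all rational characters over `ℚ` have absolute value `1`. -/
def realOne (S : QGroup n) : Set (GL (Fin n) ℝ) :=
  {g | ∃ h : g ∈ S.pts ℝ, ∀ χ : RatChar S, |((χ.app ℝ ⟨g, h⟩ : ℝˣ) : ℝ)| = 1}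

end QGroup

/-! ### Zariski topology on `GL n Qbar`, reductive groups, parabolic subgroups -/

section Zariski

variable {n : ℕ}

/-- Zariski closed subsets of `GL n Qbar`. -/
def ZClosed (Z : Set (GL (Fin n) Qbar)) : Prop :=
  ∃ I : Set (RegFun Qbar n), Z = {g | ∀ p ∈ I, evalGL p g = 0}

/-- Connectedness in the Zariski topology. -/
def ZConnected (H : Subgroup (GL (Fin n) Qbar)) : Prop :=
  ∀ Z₁ Z₂ : Set (GL (Fin n) Qbar), ZClosed Z₁ → ZClosed Z₂ → (H : Set _) ⊆ Z₁ ∪ Z₂ →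
    (H : Set _) ∩ (Z₁ ∩ Z₂) = ∅ → (H : Set _) ⊆ Z₁ ∨ (H : Set _) ⊆ Z₂

/-- `U` is a Zariski closed, connected, unipotent, normal subgroup of `H`. -/
def IsConnUnipNormal (H U : Subgroup (GL (Fin n) Qbar)) : Prop :=
  U ≤ H ∧ ZClosed (U : Set (GL (Fin n) Qbar)) ∧ ZConnected U ∧
  (∀ u ∈ U, IsNilpotent ((u : Matrix (Fin n) (Fin n) Qbar) - 1)) ∧
  ∀ h ∈ H, ∀ u ∈ U, h * u * h⁻¹ ∈ U

/-- `B` is a Zariski closed, connected, solvable subgroup of `H`. -/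
def IsConnSolvable (H B : Subgroup (GL (Fin n) Qbar)) : Prop :=
  B ≤ H ∧ ZClosed (B : Set (GL (Fin n) Qbar)) ∧ ZConnected B ∧ Group.IsSolvable B

/-- Borel subgroups: maximal Zariski closed connected solvable subgroups. -/
def IsBorel (H B : Subgroup (GL (Fin n) Qbar)) : Prop :=
  IsConnSolvable H B ∧ ∀ B', IsConnSolvable H B' → B ≤ B' → B' = B

/-- `G` is connected and reductive: its unipotent radical is trivial. -/
def IsConnReductive (G : QGroup n) : Prop :=
  ZConnected (G.pts Qbar) ∧ ∀ U, IsConnUnipNormal (G.pts Qbar) U → U = ⊥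

/-- `P` is a parabolic `ℚ`-subgroup of `G`: it contains a Borel subgroup over `Qbar`. -/
def IsParabolic (G P : QGroup n) : Prop :=
  P ≤ G ∧ ∃ B, IsBorel (G.pts Qbar) B ∧ B ≤ P.pts Qbar

/-- `N` is the unipotent radical of `P`. -/
def IsUnipRadical (P N : QGroup n) : Prop :=
  IsConnUnipNormal (P.pts Qbar) (N.pts Qbar) ∧
    ∀ U, IsConnUnipNormal (P.pts Qbar) U → U ≤ N.pts Qbar

/-- `P = L N` is a Levi decomposition, `N` being the unipotent radical of `P`. -/
def IsLevi (P N L : QGroup n) : Prop :=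
  L ≤ P ∧ L.pts Qbar ⊓ N.pts Qbar = ⊥ ∧
    ∀ g ∈ P.pts Qbar, ∃ l ∈ L.pts Qbar, ∃ u ∈ N.pts Qbar, g = l * u

/-- `S` is a `ℚ`-split torus: some characters over `ℚ` define an isomorphism onto `(GL 1)^r`. -/
def IsSplitTorus (S : QGroup n) : Prop :=
  ∃ (r : ℕ) (χ : Fin r → RatChar S), ∀ (E : Type) [CommRing E] [Algebra ℚ E],
    Function.Bijective fun (g : S.pts E) (i : Fin r) => (χ i).app E g

/-- `S` is contained in the centre of `L`. -/
def IsCentralIn (L S : QGroup n) : Prop :=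
  S ≤ L ∧ ∀ s ∈ S.pts Qbar, ∀ l ∈ L.pts Qbar, s * l = l * s

/-- `A` is the largest `ℚ`-split torus in the centre of `L`. -/
def IsSplitComponent (L A : QGroup n) : Prop :=
  (IsSplitTorus A ∧ IsCentralIn L A) ∧
    ∀ S, IsSplitTorus S → IsCentralIn L S → S ≤ A

end Zariski

/-- The dimension of a split torus: the rank of its character group. -/
def torusDim {n : ℕ} (S : QGroup n) : ℕ := Module.finrank ℤ (Additive (RatChar S))

/-- A parabolic `ℚ`-subgroup `P` of `G` with its unipotent radical `N`, a Levi component `L` and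
the split component `A` of `L`. -/
structure ParabolicDatum {n : ℕ} (G : QGroup n) where
  P : QGroup n
  L : QGroup n
  N : QGroup n
  A : QGroup n
  isParabolic : IsParabolic G P
  isUnipRadical : IsUnipRadical P N
  isLevi : IsLevi P N L
  isSplitComponent : IsSplitComponent L A

namespace ParabolicDatum

variable {n : ℕ} {G : QGroup n}

/-- `P` is a minimal parabolic `ℚ`-subgroup. -/
def IsMinimal (D : ParabolicDatum G) : Prop :=
  ∀ Q : QGroup n, IsParabolic G Q → Q ≤ D.P → Q = D.P

/-- `D` is standard with respect to `P₀ = L₀ N₀`: `P` contains `P₀` and `L` is the Levi component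
of `P` which contains `L₀`. -/
def IsStandard (D₀ D : ParabolicDatum G) : Prop :=
  D₀.P ≤ D.P ∧ D₀.L ≤ D.L

/-! ### The space `𝔞₀`, roots, coroots and fundamental weights -/

/-- The real vector space `𝔞 = Hom(X(L), ℝ)`, where `X(L)` is the group of rational characters of
`L` over `ℚ`. -/
abbrev aSpace (D : ParabolicDatum G) : Type 1 := Additive (RatChar D.L) →+ ℝ

/-- A rational character of `L` as a linear form on `𝔞`. -/
def charForm (D : ParabolicDatum G) (χ : RatChar D.L) : Module.Dual ℝ D.aSpace where
  toFun h := h (Additive.ofMul χ)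
  map_add' _ _ := rfl
  map_smul' _ _ := rfl

/-- The linear form on `𝔞` given by a character `α` of the split component `A`: a multiple
of `α` by some `m > 0` is the restriction of a character of `L`. -/
def IsFormOf (D : ParabolicDatum G) (α : RatChar D.A) (lam : Module.Dual ℝ D.aSpace) : Prop :=
  ∃ (m : ℕ) (ψ : RatChar D.L), 0 < m ∧
    (∀ (E : Type) [CommRing E] [Algebra ℚ E] (a : D.A.pts E) (b : D.L.pts E),
      (b : GL (Fin n) E) = a → ψ.app E b = α.app E a ^ m) ∧
    (m : ℝ) • lam = D.charForm ψ

end ParabolicDatum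

/-- The Lie algebra of `S`, as a set of matrices: `X` such that `1 + ε X` is a point of `S` over
the dual numbers. -/
def lieAlg {n : ℕ} (S : QGroup n) : Set (Matrix (Fin n) (Fin n) ℚ) :=
  {X | ∃ g ∈ S.pts (DualNumber ℚ), (g : Matrix (Fin n) (Fin n) (DualNumber ℚ)) =
    1 + X.map fun x => (TrivSqZeroExt.inr x : DualNumber ℚ)}

namespace ParabolicDatum

variable {n : ℕ} {G : QGroup n}

/-- The roots of `A` in the Lie algebra of `S`, as linear forms on `𝔞`. -/
def roots (D : ParabolicDatum G) (S : QGroup n) : Set (Module.Dual ℝ D.aSpace) :=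
  {lam | ∃ α : RatChar D.A, α ≠ 1 ∧ D.IsFormOf α lam ∧ ∃ X ∈ lieAlg S, X ≠ 0 ∧
    ∀ a : D.A.pts ℚ, ((a : GL (Fin n) ℚ) : Matrix (Fin n) (Fin n) ℚ) * X =
      ((α.app ℚ a : ℚˣ) : ℚ) • (X * ((a : GL (Fin n) ℚ) : Matrix (Fin n) (Fin n) ℚ))}

/-- The simple roots: the roots in the unipotent radical which are not sums of two such roots. -/
def simpleRoots (D : ParabolicDatum G) : Set (Module.Dual ℝ D.aSpace) :=
  {lam | lam ∈ D.roots D.N ∧ ∀ μ ∈ D.roots D.N, ∀ ν ∈ D.roots D.N, lam ≠ μ + ν}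

/-- `h` is the coroot of `α`: the reflection `λ ↦ λ - λ(h) α` preserves the roots, `α(h) = 2`,
and `h` is annihilated by the rational characters of `G`. -/
def IsCoroot (D : ParabolicDatum G) (α : Module.Dual ℝ D.aSpace) (h : D.aSpace) : Prop :=
  α h = 2 ∧ (∀ lam ∈ D.roots G, lam - lam h • α ∈ D.roots G) ∧
  ∀ (ψ : RatChar G) (χ : RatChar D.L),
    (∀ (E : Type) [CommRing E] [Algebra ℚ E] (g : G.pts E) (l : D.L.pts E),
      (l : GL (Fin n) E) = g → χ.app E l = ψ.app E g) → D.charForm χ h = 0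

open Classical in
/-- `ϖ` is the fundamental weight of the simple root `α`: the element dual to the coroot of `α`
in the span of the simple roots. -/
def IsFundWeight (D : ParabolicDatum G) (α ϖ : Module.Dual ℝ D.aSpace) : Prop :=
  ϖ ∈ Submodule.span ℝ D.simpleRoots ∧
    ∀ β ∈ D.simpleRoots, ∀ h, D.IsCoroot β h → ϖ h = if β = α then 1 else 0

open Classical in
/-- The function `τ̂_P` on `𝔞₀` for a standard parabolic subgroup `P = L N`: the characteristic
function of the set where all fundamental weights of the simple roots outside `L` are positive. -/
def tauHat (D₀ D : ParabolicDatum G) (h : D₀.aSpace) : ℂ :=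
  if ∀ α ∈ D₀.simpleRoots, α ∉ D₀.roots D.L → ∀ ϖ, D₀.IsFundWeight α ϖ → 0 < ϖ h then 1 else 0

/-- The homomorphism `H_L : L(𝔸) → 𝔞` with `⟨H_L(m), χ⟩ = log |χ(m)|`. -/
def hLevi (D : ParabolicDatum G) (m : D.L.pts Adele) : D.aSpace where
  toFun χ := Real.log (ideleNorm (χ.toMul.app Adele m))
  map_zero' := by simp [RatChar.one_app]
  map_add' χ ψ := by
    simp [RatChar.mul_app, Real.log_mul, ideleNorm_ne_zero]

/-- `G(𝔸) = N(𝔸) L(𝔸) K`. -/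
def HasIwasawa (D : ParabolicDatum G) (K : Subgroup (GL (Fin n) Adele)) : Prop :=
  ∀ x ∈ G.pts Adele, ∃ m : D.L.pts Adele, ∃ u ∈ D.N.pts Adele, ∃ k ∈ K,
    x = u * (m : GL (Fin n) Adele) * k

open Classical in
/-- The map `H : G(𝔸) → 𝔞` with `H(u m k) = H_L(m)` for `u ∈ N(𝔸)`, `m ∈ L(𝔸)`, `k ∈ K`. -/
def hMap (D : ParabolicDatum G) (K : Subgroup (GL (Fin n) Adele)) (x : GL (Fin n) Adele) :
    D.aSpace :=
  if h : ∃ m : D.L.pts Adele, ∃ u ∈ D.N.pts Adele, ∃ k ∈ K, x = u * (m : GL (Fin n) Adele) * k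
  then D.hLevi h.choose else 0

end ParabolicDatum

/-! ### Classes in `G(ℚ)` and ellipticity -/

section Classes

variable {n : ℕ}

/-- `s` is the semisimple component in the Jordan decomposition of `γ`. -/
def IsSemisimplePart (γ s : GL (Fin n) ℚ) : Prop :=
  Module.End.IsSemisimple (Matrix.toLin' (s : Matrix (Fin n) (Fin n) ℚ)) ∧ s * γ = γ * s ∧
    IsNilpotent (((s⁻¹ * γ : GL (Fin n) ℚ) : Matrix (Fin n) (Fin n) ℚ) - 1)

/-- The semisimple components of `γ` and `γ'` are conjugate in `G(ℚ)`. -/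
def ClassEquiv (G : QGroup n) (γ γ' : GL (Fin n) ℚ) : Prop :=
  ∃ s s' : GL (Fin n) ℚ, IsSemisimplePart γ s ∧ IsSemisimplePart γ' s' ∧
    ∃ g ∈ G.pts ℚ, g * s * g⁻¹ = s'

/-- `𝔬` is an equivalence class in `G(ℚ)` for the relation `ClassEquiv`. -/
def IsClass (G : QGroup n) (𝔬 : Set (GL (Fin n) ℚ)) : Prop :=
  ∃ γ₀ ∈ G.pts ℚ, 𝔬 = {γ | γ ∈ G.pts ℚ ∧ ClassEquiv G γ γ₀}

/-- `γ` lies in no parabolic `ℚ`-subgroup other than `G`. -/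
def IsEllipticElt (G : QGroup n) (γ : GL (Fin n) ℚ) : Prop :=
  ∀ P : QGroup n, IsParabolic G P → γ ∈ P.pts ℚ → P = G

/-- A class is `ℚ`-elliptic if some element of it is. -/
def IsEllipticClass (G : QGroup n) (𝔬 : Set (GL (Fin n) ℚ)) : Prop :=
  ∃ γ ∈ 𝔬, IsEllipticElt G γ

end Classes

/-! ### Test functions -/

section TestFunctions

variable {n : ℕ}

/-- The Borel σ-algebra on `GL n 𝔸`. -/
instance : MeasurableSpace (GL (Fin n) Adele) := borel _

instance : BorelSpace (GL (Fin n) Adele) := ⟨rfl⟩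

/-- The component at the infinite place. -/
def infPart : GL (Fin n) Adele →* GL (Fin n) ℝ :=
  Matrix.GeneralLinearGroup.map (RingHom.fst ℝ AFin)

/-- The component at the finite places. -/
def finPart : GL (Fin n) Adele →* GL (Fin n) AFin :=
  Matrix.GeneralLinearGroup.map (RingHom.snd ℝ AFin)

/-- The diagonal embedding. -/
def diag : GL (Fin n) ℚ →* GL (Fin n) Adele :=
  Matrix.GeneralLinearGroup.map (algebraMap ℚ Adele)

/-- `f ∈ C_c^∞(G(𝔸)¹)`: compactly supported, and near each point a smooth function of the infinite
component alone. -/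
def IsTestFunction {G : QGroup n} (f : G.adelicOne → ℂ) : Prop :=
  HasCompactSupport f ∧
    ∀ x : G.adelicOne, ∃ Φ : (Fin n → Fin n → ℝ) → ℂ, ContDiff ℝ ∞ Φ ∧
      ∀ᶠ h in 𝓝 (1 : G.adelicOne),
        f (x * h) = Φ fun i j => (infPart (h : GL (Fin n) Adele) : Matrix (Fin n) (Fin n) ℝ) i j

/-- `f` is parabolically regular at the infinite place: for some compact open subgroup `Kfin` of
`G(𝔸_fin)` it is supported on `Kfin × G(ℝ)¹` and vanishes on all conjugates of `Kfin × P(ℝ)¹` under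
`G(ℝ)`, for every parabolic `ℚ`-subgroup `P ≠ G`. -/
def IsParabolicallyRegular {G : QGroup n} (f : G.adelicOne → ℂ) : Prop :=
  ∃ Kfin : Subgroup (GL (Fin n) AFin), Kfin ≤ G.pts AFin ∧
    IsCompact (Kfin : Set (GL (Fin n) AFin)) ∧
    IsOpen {g : G.pts AFin | (g : GL (Fin n) AFin) ∈ Kfin} ∧
    (∀ x : G.adelicOne, f x ≠ 0 →
      finPart (x : GL (Fin n) Adele) ∈ Kfin ∧ infPart (x : GL (Fin n) Adele) ∈ G.realOne) ∧
    ∀ P : QGroup n, IsParabolic G P → P ≠ G →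
      ∀ x : G.adelicOne, finPart (x : GL (Fin n) Adele) ∈ Kfin →
        ∀ g ∈ G.pts ℝ, ∀ p ∈ P.realOne,
          infPart (x : GL (Fin n) Adele) = g * p * g⁻¹ → f x = 0

end TestFunctions

/-! ### Kernels and the geometric terms -/

section Kernels

variable {n : ℕ} {G : QGroup n}

/-- `K_{P,𝔬}(x, y) = ∑_{γ ∈ L(ℚ) ∩ 𝔬} ∫_{N(𝔸)} f(x⁻¹ γ u y) du` with respect to the measure `ν` on
`N(𝔸)`. The arguments of `f` that occur for `x, y ∈ G(𝔸)` with `x = y` or for `x, y ∈ G(𝔸)¹` lie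
in `G(𝔸)¹`; the extension by zero only serves to make the formula meaningful without a proof. -/
def kernel (f : G.adelicOne → ℂ) (𝔬 : Set (GL (Fin n) ℚ)) (D : ParabolicDatum G)
    (ν : Measure (D.N.pts Adele)) (x y : GL (Fin n) Adele) : ℂ :=
  ∑' γ : {γ : GL (Fin n) ℚ // γ ∈ D.L.pts ℚ ∧ γ ∈ 𝔬},
    ∫ u : D.N.pts Adele,
      Function.extend Subtype.val f 0 (x⁻¹ * diag γ.1 * (u : GL (Fin n) Adele) * y) ∂ν

/-- The coset space `P(ℚ) \ G(ℚ)`. -/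
abbrev RatCosets (D : ParabolicDatum G) : Type :=
  Quotient (QuotientGroup.rightRel ((D.P.pts ℚ).subgroupOf (G.pts ℚ)))

/-- The function `k_𝔬`, i.e. the sum over the standard parabolic subgroups `P` of
`(-1)^{dim A_P / A_G} ∑_{δ ∈ P(ℚ)\G(ℚ)} K_{P,𝔬}(δx, δx) τ̂_P(H(δx) - T)`. Here `D₀` is the minimal
parabolic subgroup and `DG` is `G` itself. -/
def kFun (D₀ DG : ParabolicDatum G) (K : Subgroup (GL (Fin n) Adele)) (T : D₀.aSpace)
    (ν : ∀ D : ParabolicDatum G, Measure (D.N.pts Adele))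
    (f : G.adelicOne → ℂ) (𝔬 : Set (GL (Fin n) ℚ)) (x : GL (Fin n) Adele) : ℂ :=
  ∑ᶠ D : {D : ParabolicDatum G // D₀.IsStandard D},
    (-1 : ℂ) ^ (torusDim D.1.A - torusDim DG.A) *
      ∑' δ : RatCosets D.1,
        kernel f 𝔬 D.1 (ν D.1) (diag δ.out.1 * x) (diag δ.out.1 * x) *
          D₀.tauHat D.1 (D₀.hMap K (diag δ.out.1 * x) - T)

/-- `G(ℚ)` as a subgroup of `G(𝔸)¹`. -/
def ratSubgroup (G : QGroup n) : Subgroup G.adelicOne :=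
  ((G.pts ℚ).map diag).subgroupOf G.adelicOne

/-- `J_𝔬(f)`, the integral of `k_𝔬` over `G(ℚ) \ G(𝔸)¹`, computed on a fundamental domain `F` of
`G(ℚ)` in `G(𝔸)¹` with respect to the Haar measure `μ`. -/
def geomTerm (D₀ DG : ParabolicDatum G) (K : Subgroup (GL (Fin n) Adele)) (T : D₀.aSpace)
    (ν : ∀ D : ParabolicDatum G, Measure (D.N.pts Adele)) (μ : Measure G.adelicOne)
    (F : Set G.adelicOne) (f : G.adelicOne → ℂ) (𝔬 : Set (GL (Fin n) ℚ)) : ℂ :=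
  ∫ x in F, kFun D₀ DG K T ν f 𝔬 (x : GL (Fin n) Adele) ∂μ

end Kernels

end SimpleTrace

end

open SimpleTrace

namespace SimpleTrace

/-! ### Functoriality of points and characters -/

section Functoriality

variable {n : ℕ} {E E' : Type} [CommRing E] [Algebra ℚ E] [CommRing E'] [Algebra ℚ E']

/-! The identity `k_𝔬(x) = K_{G,𝔬}(x,x)` holds pointwise, so no convergence argument is needed. Let
`P ≠ G` be parabolic, `γ ∈ P(ℚ)`, `u ∈ P(𝔸)` unipotent, and suppose `f(x⁻¹γux) ≠ 0`. A rational
character `χ` of `P` is trivial on unipotent elements (`RatChar.app_eq_one_of_isNilpotent`), so at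
every place `χ(γu)` is the rational number `χ(γ)`. The finite part of `γu` is conjugate into the
compact group `Kfin`, so `|χ(γ)|_p = 1` for all `p` (`norm_app_eq_one`), and the product formula
(`abs_eq_one_of_finEval`) gives `|χ(γ)|_∞ = 1`. Thus the infinite part of `γu` lies in `P(ℝ)¹`
(`infPart_mem_realOne`), where parabolic regularity makes `f` vanish, a contradiction
(`IsParabolicallyRegular.extend_eq_zero`). With `u ∈ N(𝔸)` this kills every `K_{P,𝔬}` with `P ≠ G`,
and the term of `G` has one coset, sign `1` and `τ̂_G = 1` (`kFun_eq_kernel`). If `𝔬` is not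
elliptic, each `γ ∈ 𝔬` lies in some proper `P`, and the case `u = 1` kills `K_{G,𝔬}` as well. -/

theorem evalGL_map (φ : E →+* E') (p : RegFun ℚ n) (g : GL (Fin n) E) :
    evalGL p (Matrix.GeneralLinearGroup.map φ g) = φ (evalGL p g) := by
  have h : φ (evalGL p g) = φ.toRatAlgHom (evalGL p g) := rfl
  rw [h, evalGL, evalGL, ← AlgHom.comp_apply, MvPolynomial.comp_aeval]
  congr 2
  funext ij
  rcases ij with ij | ij
  · rfl
  · simp only [Sum.elim_inr, ← map_inv]
    rfl

theorem map_mem_pts (S : QGroup n) (φ : E →+* E') {g : GL (Fin n) E} (hg : g ∈ S.pts E) :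
    Matrix.GeneralLinearGroup.map φ g ∈ S.pts E' := by
  rw [S.mem_pts_iff] at hg ⊢
  intro p hp
  rw [evalGL_map, hg p hp, map_zero]

/-- Naturality is not a field of `RatChar`; it follows because one polynomial over `ℚ` computes the
character over every `E`. -/
theorem RatChar.app_map {S : QGroup n} (χ : RatChar S) (φ : E →+* E') {g : GL (Fin n) E}
    (hg : g ∈ S.pts E) :
    (χ.app E' ⟨_, map_mem_pts S φ hg⟩ : E') = φ (χ.app E ⟨g, hg⟩) := by
  obtain ⟨p, hp⟩ := χ.regular
  rw [hp, hp, evalGL_map]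

theorem QGroup.le_of_Qbar {S T : QGroup n} (h : S.pts Qbar ≤ T.pts Qbar) : S ≤ T := by
  intro E _ _ g hg
  rw [S.mem_pts_iff] at hg
  rw [T.mem_pts_iff]
  exact fun p hp => hg p fun k hk => hp k (h hk)

theorem QGroup.le_antisymm {S T : QGroup n} (h : S ≤ T) (h' : T ≤ S) : S = T := by
  ext E _ _ g
  exact ⟨fun hg => h E hg, fun hg => h' E hg⟩

/-- The functions `g_ij - δ_ij` vanish on the geometric points, hence are among the equations of
`S`. -/
theorem pts_eq_one_of_Qbar {S : QGroup n} (h : S.pts Qbar = ⊥) {g : GL (Fin n) E}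
    (hg : g ∈ S.pts E) : g = 1 := by
  rw [S.mem_pts_iff] at hg
  refine Units.ext (Matrix.ext fun i j => ?_)
  have h1 := hg (MvPolynomial.X (Sum.inl (i, j)) - MvPolynomial.C ((1 : Matrix _ _ ℚ) i j))
    fun k hk => by
      rw [h, Subgroup.mem_bot] at hk
      subst hk
      by_cases hij : i = j <;> simp [evalGL, Matrix.one_apply, hij]
  simp only [evalGL, map_sub, MvPolynomial.aeval_X, MvPolynomial.aeval_C, Sum.elim_inl] at h1
  rw [sub_eq_zero.1 h1]
  by_cases hij : i = j <;> simp [Matrix.one_apply, hij]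

/-- Cayley–Hamilton. The uniform exponent `n` turns unipotence into a polynomial condition. -/
theorem Matrix.pow_eq_zero_of_isNilpotent {k : Type*} [Field k] {M : Matrix (Fin n) (Fin n) k}
    (hM : IsNilpotent M) : M ^ n = 0 := by
  have h := (Matrix.isNilpotent_charpoly_sub_pow_of_isNilpotent hM).eq_zero
  have h2 := M.aeval_self_charpoly
  rw [sub_eq_zero.1 h] at h2
  simpa using h2

/-- The points of a group with unipotent geometric points are unipotent. -/
theorem isNilpotent_of_Qbar {S : QGroup n}
    (h : ∀ u ∈ S.pts Qbar, IsNilpotent ((u : Matrix (Fin n) (Fin n) Qbar) - 1))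
    {g : GL (Fin n) E} (hg : g ∈ S.pts E) :
    IsNilpotent ((g : Matrix (Fin n) (Fin n) E) - 1) := by
  rw [S.mem_pts_iff] at hg
  -- For the generic matrix `X`, the entries of `(X - 1) ^ n` are regular functions vanishing on the
  -- geometric points.
  let X : Matrix (Fin n) (Fin n) (RegFun ℚ n) := .of fun i j => MvPolynomial.X (Sum.inl (i, j))
  have key : ∀ (R : Type) [CommRing R] [Algebra ℚ R] (g : GL (Fin n) R) (i j : Fin n),
      evalGL (((X - 1) ^ n) i j) g = (((g : Matrix (Fin n) (Fin n) R) - 1) ^ n) i j := by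
    intro R _ _ g i j
    let φ : RegFun ℚ n →ₐ[ℚ] R := MvPolynomial.aeval
      (Sum.elim (fun ij => (g : Matrix (Fin n) (Fin n) R) ij.1 ij.2)
      (fun ij => ((g⁻¹ : GL (Fin n) R) : Matrix (Fin n) (Fin n) R) ij.1 ij.2))
    have hX : φ.mapMatrix X = (g : Matrix (Fin n) (Fin n) R) := by
      ext a b
      simp [X, φ]
    have h3 : φ.mapMatrix ((X - 1) ^ n) = ((g : Matrix (Fin n) (Fin n) R) - 1) ^ n := by
      rw [map_pow, map_sub, map_one, hX]
    exact congrFun (congrFun h3 i) j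
  refine ⟨n, Matrix.ext fun i j => ?_⟩
  rw [← key]
  refine hg _ fun k hk => ?_
  rw [key, Matrix.pow_eq_zero_of_isNilpotent (h k hk)]
  rfl

end Functoriality

/-! ### Characters are trivial on unipotent elements -/

section Unipotent

variable {n : ℕ} {E : Type} [Field E] [Algebra ℚ E]

/-- The powers of a unipotent matrix depend polynomially on the exponent. -/
theorem exists_polynomial_pow {M : Matrix (Fin n) (Fin n) E} (hM : IsNilpotent (M - 1)) :
    ∃ U : Fin n → Fin n → Polynomial E, ∀ (k : ℕ) i j, (U i j).eval (k : E) = (M ^ k) i j := by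
  have := algebraRat.charZero E
  obtain ⟨N, hN⟩ := hM
  -- Expand `(1 + (M - 1)) ^ k`: only `m < N` contributes, and `k.choose m` is polynomial in `k` in
  -- characteristic zero.
  refine ⟨fun i j => ∑ m ∈ Finset.range N,
    Polynomial.C ((m.factorial : E)⁻¹ * ((M - 1) ^ m) i j) * descPochhammer E m, fun k i j => ?_⟩
  have h1 : M ^ k = ∑ m ∈ Finset.range N, k.choose m • (M - 1) ^ m := by
    have h2 : M ^ k = ∑ m ∈ Finset.range (k + 1), k.choose m • (M - 1) ^ m := by
      conv_lhs => rw [← sub_add_cancel M 1, (Commute.one_right (M - 1)).add_pow]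
      exact Finset.sum_congr rfl fun m _ => by simp [nsmul_eq_mul, Nat.cast_comm]
    have h3 : ∀ m, k + 1 ≤ m → k.choose m • (M - 1) ^ m = 0 := fun m hm => by
      rw [Nat.choose_eq_zero_of_lt (by omega), zero_smul]
    have h4 : ∀ m, N ≤ m → k.choose m • (M - 1) ^ m = 0 := fun m hm => by
      rw [pow_eq_zero_of_le hm hN, smul_zero]
    rw [h2]
    rcases le_total N (k + 1) with h | h
    · exact (Finset.sum_subset (Finset.range_mono h) fun m _ hm => h4 m (by simpa using hm)).symm
    · exact Finset.sum_subset (Finset.range_mono h) fun m _ hm => h3 m (by simpa using hm)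
  rw [h1, Polynomial.eval_finsetSum, Matrix.sum_apply]
  refine Finset.sum_congr rfl fun m _ => ?_
  have h5 : ((m.factorial : ℕ) : E) ≠ 0 := Nat.cast_ne_zero.2 m.factorial_ne_zero
  rw [Polynomial.eval_mul, Polynomial.eval_C, descPochhammer_eval_eq_descFactorial,
    Nat.descFactorial_eq_factorial_mul_choose, Matrix.smul_apply, nsmul_eq_mul, Nat.cast_mul]
  field_simp

/-- Regular functions are polynomial along the powers of a unipotent element. -/
theorem exists_polynomial_evalGL (p : RegFun ℚ n) {u : GL (Fin n) E}
    (hu : IsNilpotent ((u : Matrix (Fin n) (Fin n) E) - 1)) :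
    ∃ Q : Polynomial E, ∀ k : ℕ, Q.eval (k : E) = evalGL p (u ^ k) := by
  -- Regular functions also involve the entries of the inverse, so `u⁻¹` must be unipotent too.
  have hu' : IsNilpotent (((u⁻¹ : GL (Fin n) E) : Matrix (Fin n) (Fin n) E) - 1) := by
    have h : ((u⁻¹ : GL (Fin n) E) : Matrix (Fin n) (Fin n) E) - 1 =
        -((u⁻¹ : GL (Fin n) E) : Matrix (Fin n) (Fin n) E) *
          ((u : Matrix (Fin n) (Fin n) E) - 1) := by
      rw [mul_sub, neg_mul, mul_one, Units.inv_mul]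
      abel
    rw [h]
    refine Commute.isNilpotent_mul_left ?_ hu
    refine ((Commute.sub_right ?_ (Commute.one_right _))).neg_left
    exact (Commute.refl (u : Matrix (Fin n) (Fin n) E)).units_inv_left
  obtain ⟨U, hU⟩ := exists_polynomial_pow hu
  obtain ⟨V, hV⟩ := exists_polynomial_pow hu'
  refine ⟨MvPolynomial.aeval (Sum.elim (fun ij => U ij.1 ij.2) fun ij => V ij.1 ij.2) p,
    fun k => ?_⟩
  have h : ∀ q : Polynomial E, q.eval (k : E) =
    (Polynomial.evalRingHom (k : E)).toRatAlgHom q := fun _ => rfl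
  rw [h, evalGL, ← AlgHom.comp_apply, MvPolynomial.comp_aeval]
  congr 2
  funext ij
  rcases ij with ij | ij
  · simp only [Sum.elim_inl, ← h, hU]
    simp
  · simp only [Sum.elim_inr, ← h, hV, ← inv_pow, Units.val_pow_eq_pow_val]

/-- Both `χ(u)^k` and `χ(u)^(-k)` are polynomial in `k`. Their product is `1` at infinitely many
`k`, so both polynomials are constant; compare `k = 0` and `k = 1`. -/
theorem RatChar.app_eq_one_of_isNilpotent {S : QGroup n} (χ : RatChar S) {u : GL (Fin n) E}
    (hu : u ∈ S.pts E) (hn : IsNilpotent ((u : Matrix (Fin n) (Fin n) E) - 1)) :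
    χ.app E ⟨u, hu⟩ = 1 := by
  have := algebraRat.charZero E
  have key : ∀ ψ : RatChar S, ∃ Q : Polynomial E, ∀ k : ℕ,
      Q.eval (k : E) = ((ψ.app E ⟨u, hu⟩ ^ k : Eˣ) : E) := by
    intro ψ
    obtain ⟨p, hp⟩ := ψ.regular
    obtain ⟨Q, hQ⟩ := exists_polynomial_evalGL p hn
    exact ⟨Q, fun k => by rw [hQ, ← map_pow, hp]; rfl⟩
  obtain ⟨Q, hQ⟩ := key χ
  obtain ⟨R, hR⟩ := key χ⁻¹
  have hQR : Q * R = 1 := by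
    refine Polynomial.eq_of_infinite_eval_eq _ _
      ((Set.infinite_range_of_injective (Nat.cast_injective (R := E))).mono ?_)
    rintro _ ⟨k, rfl⟩
    simp [hQ, hR, RatChar.inv_app]
  obtain ⟨c, -, rfl⟩ := Polynomial.isUnit_iff.1 (IsUnit.of_mul_eq_one _ hQR)
  have h0 := hQ 0
  have h1 := hQ 1
  simp only [Polynomial.eval_C, pow_zero, pow_one] at h0 h1
  exact Units.ext (h1.symm.trans h0)

end Unipotent

/-! ### Compact subgroups and the product formula -/

section Compact

variable {n : ℕ}

/-- The projection of the finite adeles to a local field. -/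
noncomputable def finEval (v : FinPlace) : AFin →+* v.adicCompletion ℚ :=
  RestrictedProduct.evalRingHom (fun v : FinPlace => v.adicCompletion ℚ) v

theorem continuous_finEval (v : FinPlace) : Continuous (finEval v) :=
  RestrictedProduct.continuous_eval v

theorem continuous_evalGL {E : Type} [CommRing E] [Algebra ℚ E] [TopologicalSpace E]
    [IsTopologicalRing E] (p : RegFun ℚ n) : Continuous fun g : GL (Fin n) E => evalGL p g := by
  simp only [evalGL, MvPolynomial.aeval_def, MvPolynomial.eval₂_eq]
  refine continuous_finsetSum _ fun d _ => continuous_const.mul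
    (continuous_finsetProd _ fun ij _ => Continuous.pow ?_ _)
  rcases ij with ij | ij
  · exact Units.continuous_val.matrix_elem ij.1 ij.2
  · exact Units.continuous_coe_inv.matrix_elem ij.1 ij.2

/-- A rational number which is a unit at all finite places has absolute value `1`. -/
theorem abs_eq_one_of_finEval (q : ℚˣ)
    (h : ∀ v : FinPlace, ‖finEval v (algebraMap ℚ AFin q)‖ = 1) : |(q : ℚ)| = 1 := by
  have h1 := FinitePlace.prod_eq_inv_abs_norm (K := ℚ) q.ne_zero
  rw [finprod_eq_one_of_forall_eq_one,
    Subsingleton.elim (DivisionRing.toRatAlgebra : Algebra ℚ ℚ) (Algebra.id ℚ),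
    Algebra.norm_self] at h1
  · have h2 : ((|(q : ℚ)| : ℚ) : ℝ)⁻¹ = 1 := by
      rw [h1]; simp
    rw [inv_eq_one] at h2
    exact_mod_cast h2
  · intro w
    rw [← FinitePlace.norm_embedding_eq]
    exact h w.maximalIdeal

theorem eq_one_of_zpow_le {a B : ℝ} (ha : 0 < a) (h : ∀ k : ℤ, a ^ k ≤ B) : a = 1 := by
  have key : ∀ b : ℝ, (∀ k : ℕ, b ^ k ≤ B) → b ≤ 1 := by
    intro b hb
    by_contra! h1
    obtain ⟨k, hk⟩ := pow_unbounded_of_one_lt B h1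
    exact absurd (hb k) (not_le.2 hk)
  refine le_antisymm (key a fun k => by simpa using h k) ?_
  rw [← inv_le_one₀ ha]
  exact key _ fun k => by simpa using h (-k)

/-- Characters take values of local absolute value `1` on elements of `S(𝔸_fin)` which are
contained in a compact subgroup of `GL n 𝔸_fin` up to conjugacy. -/
theorem norm_app_eq_one {S : QGroup n} (χ : RatChar S) {C : Subgroup (GL (Fin n) AFin)}
    (hC : IsCompact (C : Set (GL (Fin n) AFin))) (x : GL (Fin n) AFin) {g : GL (Fin n) AFin}
    (hg : g ∈ S.pts AFin) (hgC : x⁻¹ * g * x ∈ C) (v : FinPlace) :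
    ‖finEval v (χ.app AFin ⟨g, hg⟩ : AFinˣ)‖ = 1 := by
  obtain ⟨p, hp⟩ := χ.regular
  -- Since `x * c * x⁻¹` need not lie in `S`, the polynomial `p` replaces `χ`. Its bound on `C`
  -- bounds all integral powers of `|χ(g)|_v`.
  have hcont : Continuous fun c : GL (Fin n) AFin => ‖finEval v (evalGL p (x * c * x⁻¹))‖ :=
    continuous_norm.comp ((continuous_finEval v).comp
      ((continuous_evalGL p).comp (by fun_prop)))
  obtain ⟨B, hB⟩ := (hC.image hcont).bddAbove
  have hne : 0 < ‖finEval v (χ.app AFin ⟨g, hg⟩ : AFinˣ)‖ :=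
    norm_pos_iff.2 (((χ.app AFin ⟨g, hg⟩).isUnit.map (finEval v)).ne_zero)
  refine eq_one_of_zpow_le hne (B := B) fun k => ?_
  have h1 := hB ⟨_, zpow_mem hgC k, rfl⟩
  have h2 : x * (x⁻¹ * g * x) ^ k * x⁻¹ = ((⟨g, hg⟩ ^ k : S.pts AFin) : GL (Fin n) AFin) := by
    have := conj_zpow (a := x⁻¹) (b := g) (i := k)
    rw [inv_inv] at this
    rw [this]
    simp [mul_assoc]
  simp only [h2, ← hp, map_zpow] at h1
  refine (le_of_eq ?_).trans h1
  rw [← norm_zpow]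
  congr 1
  exact (Units.val_zpow_eq_zpow_val
    (Units.map (finEval v).toMonoidHom (χ.app AFin ⟨g, hg⟩)) k).symm.trans
    (by rw [← map_zpow]; rfl)

theorem diag_mem_pts {S : QGroup n} {γ : GL (Fin n) ℚ} (hγ : γ ∈ S.pts ℚ) :
    diag γ ∈ S.pts Adele := map_mem_pts S _ hγ

theorem isNilpotent_map {E E' : Type} [CommRing E] [CommRing E'] (φ : E →+* E')
    {u : GL (Fin n) E} (hn : IsNilpotent ((u : Matrix (Fin n) (Fin n) E) - 1)) :
    IsNilpotent (((Matrix.GeneralLinearGroup.map φ u : GL (Fin n) E') :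
      Matrix (Fin n) (Fin n) E') - 1) := by
  have h := hn.map φ.mapMatrix
  rwa [map_sub, map_one] at h

/-- The infinite component of `γ u`, with `γ ∈ P(ℚ)` and `u ∈ P(𝔸)` unipotent, lies in `P(ℝ)¹` if
the finite component lies in a compact subgroup up to conjugacy. -/
theorem infPart_mem_realOne {P : QGroup n} {γ : GL (Fin n) ℚ} (hγ : γ ∈ P.pts ℚ)
    {u : GL (Fin n) Adele} (hu : u ∈ P.pts Adele)
    (hn : IsNilpotent ((u : Matrix (Fin n) (Fin n) Adele) - 1))
    {C : Subgroup (GL (Fin n) AFin)} (hC : IsCompact (C : Set (GL (Fin n) AFin)))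
    (x : GL (Fin n) AFin) (hx : x⁻¹ * finPart (diag γ * u) * x ∈ C) :
    infPart (diag γ * u) ∈ P.realOne := by
  have hmem : diag γ * u ∈ P.pts Adele := mul_mem (diag_mem_pts hγ) hu
  -- Triviality on unipotents is available over fields, so one works at each place separately; there
  -- `u` drops out and the rational number `χ(γ)` remains.
  have app_prod : ∀ (E : Type) [Field E] [Algebra ℚ E] (φ : Adele →+* E) (χ : RatChar P),
      (χ.app E ⟨Matrix.GeneralLinearGroup.map φ (diag γ * u), map_mem_pts P φ hmem⟩ : E) =
        φ (algebraMap ℚ Adele (χ.app ℚ ⟨γ, hγ⟩ : ℚˣ)) := by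
    intro E _ _ φ χ
    have h1 := χ.app_eq_one_of_isNilpotent (map_mem_pts P φ hu) (isNilpotent_map φ hn)
    have h2 : (⟨Matrix.GeneralLinearGroup.map φ (diag γ * u), map_mem_pts P φ hmem⟩ : P.pts E) =
      ⟨_, map_mem_pts P φ (diag_mem_pts hγ)⟩ * ⟨_, map_mem_pts P φ hu⟩ :=
      Subtype.ext (map_mul _ _ _)
    rw [h2, map_mul, h1, mul_one]
    exact (χ.app_map φ (diag_mem_pts hγ)).trans (congrArg φ (χ.app_map (algebraMap ℚ Adele) hγ))
  refine ⟨map_mem_pts P _ hmem, fun χ => ?_⟩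
  have h3 : |((χ.app ℚ ⟨γ, hγ⟩ : ℚˣ) : ℚ)| = 1 := by
    refine abs_eq_one_of_finEval _ fun v => ?_
    have h4 := norm_app_eq_one χ hC x (map_mem_pts P (RingHom.snd ℝ AFin) hmem) hx v
    rw [← h4]
    congr 1
    rw [χ.app_map (RingHom.snd ℝ AFin) hmem]
    have h5 := app_prod _ ((finEval v).comp (RingHom.snd ℝ AFin)) χ
    rw [χ.app_map _ hmem] at h5
    exact h5.symm
  have h6 := app_prod ℝ (RingHom.fst ℝ AFin) χ
  change |((χ.app ℝ ⟨Matrix.GeneralLinearGroup.map (RingHom.fst ℝ AFin) (diag γ * u),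
    map_mem_pts P (RingHom.fst ℝ AFin) hmem⟩ : ℝˣ) : ℝ)| = 1
  rw [h6]
  change |(((χ.app ℚ ⟨γ, hγ⟩ : ℚˣ) : ℚ) : ℝ)| = 1
  exact_mod_cast h3

/-- A parabolically regular function vanishes on the conjugates of `γ u` for `γ ∈ P(ℚ)` and
unipotent `u ∈ P(𝔸)`, where `P ≠ G` is a parabolic subgroup. -/
theorem IsParabolicallyRegular.extend_eq_zero {G P : QGroup n} {f : G.adelicOne → ℂ}
    (hreg : IsParabolicallyRegular f) (hP : IsParabolic G P) (hPG : P ≠ G)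
    {γ : GL (Fin n) ℚ} (hγ : γ ∈ P.pts ℚ) {u : GL (Fin n) Adele} (hu : u ∈ P.pts Adele)
    (hn : IsNilpotent ((u : Matrix (Fin n) (Fin n) Adele) - 1))
    {x : GL (Fin n) Adele} (hx : x ∈ G.pts Adele) :
    Function.extend Subtype.val f 0 (x⁻¹ * diag γ * u * x) = 0 := by
  obtain ⟨C, -, hC, -, hsupp, hvan⟩ := hreg
  by_cases hy : ∃ y : G.adelicOne, (y : GL (Fin n) Adele) = x⁻¹ * diag γ * u * x
  · obtain ⟨y, hy⟩ := hy
    rw [← hy, Subtype.val_injective.extend_apply]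
    by_contra hne
    have hfin := (hsupp y hne).1
    -- The infinite part of `x⁻¹γux` is the conjugate of that of `γu` by `x_∞⁻¹`.
    refine hne (hvan P hP hPG y hfin (infPart x)⁻¹ (inv_mem (map_mem_pts G _ hx))
      (infPart (diag γ * u)) ?_ ?_)
    · refine infPart_mem_realOne hγ hu hn hC (finPart x) ?_
      rw [hy] at hfin
      simpa [mul_assoc] using hfin
    · rw [hy]
      simp [mul_assoc]
  · rw [Function.extend_apply' _ _ _ hy]
    rfl

end Compact

/-! ### The kernels -/

section KernelFormulas

variable {n : ℕ} {G : QGroup n}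

namespace ParabolicDatum

theorem N_le_P (D : ParabolicDatum G) : D.N ≤ D.P :=
  QGroup.le_of_Qbar D.isUnipRadical.1.1

theorem isNilpotent_sub_one (D : ParabolicDatum G) (u : D.N.pts Adele) :
    IsNilpotent (((u : GL (Fin n) Adele) : Matrix (Fin n) (Fin n) Adele) - 1) :=
  isNilpotent_of_Qbar D.isUnipRadical.1.2.2.2.1 u.2

theorem N_Qbar_eq_bot (hG : IsConnReductive G) {D : ParabolicDatum G} (hD : D.P = G) :
    D.N.pts Qbar = ⊥ :=
  hG.2 _ (by simpa only [hD] using D.isUnipRadical.1)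

theorem L_eq (hG : IsConnReductive G) {D : ParabolicDatum G} (hD : D.P = G) : D.L = G := by
  refine QGroup.le_antisymm (by simpa only [hD] using D.isLevi.1) (QGroup.le_of_Qbar fun g hg => ?_)
  obtain ⟨l, hl, u, hu, rfl⟩ := D.isLevi.2.2 g (hD.symm ▸ hg)
  rw [N_Qbar_eq_bot hG hD, Subgroup.mem_bot] at hu
  rwa [hu, mul_one]

/-- The group `G` has a unique parabolic datum. -/
theorem eq_of_P_eq (hG : IsConnReductive G) {D D' : ParabolicDatum G} (hD : D.P = G)
    (hD' : D'.P = G) : D = D' := by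
  have hL : D.L = D'.L := (L_eq hG hD).trans (L_eq hG hD').symm
  have hN : D.N = D'.N := by
    refine QGroup.le_antisymm (QGroup.le_of_Qbar ?_) (QGroup.le_of_Qbar ?_) <;>
      rw [N_Qbar_eq_bot hG hD, N_Qbar_eq_bot hG hD']
  have hA : D.A = D'.A :=
    QGroup.le_antisymm
      (D'.isSplitComponent.2 _ D.isSplitComponent.1.1 (hL ▸ D.isSplitComponent.1.2))
      (D.isSplitComponent.2 _ D'.isSplitComponent.1.1 (hL ▸ D'.isSplitComponent.1.2))
  cases D
  cases D'
  simp_all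

theorem roots_mono (D : ParabolicDatum G) {S T : QGroup n} (h : S ≤ T) :
    D.roots S ⊆ D.roots T := by
  rintro lam ⟨α, hα, hlam, X, ⟨g, hg, hgX⟩, hX0, hX⟩
  exact ⟨α, hα, hlam, X, ⟨g, h _ hg, hgX⟩, hX0, hX⟩

theorem N_le (D : ParabolicDatum G) : D.N ≤ G :=
  fun E _ _ _ h => D.isParabolic.1 E (D.N_le_P E h)

theorem isStandard_of_P_eq (hG : IsConnReductive G) (D₀ : ParabolicDatum G)
    {D : ParabolicDatum G} (hD : D.P = G) : D₀.IsStandard D := by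
  refine ⟨hD.symm ▸ D₀.isParabolic.1, ?_⟩
  rw [L_eq hG hD]
  exact fun E _ _ _ h => D₀.isParabolic.1 E (D₀.isLevi.1 E h)

/-- No simple root lies outside `L = G`, so the defining condition is vacuous. -/
theorem tauHat_of_P_eq (hG : IsConnReductive G) (D₀ : ParabolicDatum G)
    {D : ParabolicDatum G} (hD : D.P = G) (h : D₀.aSpace) : D₀.tauHat D h = 1 := by
  refine if_pos fun α hα hα' => absurd ?_ hα'
  rw [L_eq hG hD]
  exact D₀.roots_mono D₀.N_le hα.1

end ParabolicDatum

open ParabolicDatum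

theorem mem_pts_of_adelicOne (x : G.adelicOne) : (x : GL (Fin n) Adele) ∈ G.pts Adele :=
  x.2.choose

theorem kernel_eq_zero {f : G.adelicOne → ℂ} (hreg : IsParabolicallyRegular f)
    (𝔬 : Set (GL (Fin n) ℚ)) {D : ParabolicDatum G} (hD : D.P ≠ G) (ν : Measure (D.N.pts Adele))
    {x : GL (Fin n) Adele} (hx : x ∈ G.pts Adele) : kernel f 𝔬 D ν x x = 0 := by
  have h : ∀ (γ : {γ : GL (Fin n) ℚ // γ ∈ D.L.pts ℚ ∧ γ ∈ 𝔬}) (u : D.N.pts Adele),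
      Function.extend Subtype.val f 0 (x⁻¹ * diag γ.1 * (u : GL (Fin n) Adele) * x) = 0 :=
    fun γ u => hreg.extend_eq_zero D.isParabolic hD (D.isLevi.1 ℚ γ.2.1) (D.N_le_P _ u.2)
      (D.isNilpotent_sub_one u) hx
  simp [kernel, h]

/-- Here `N` is trivial. The proper parabolic subgroup containing `γ` may vary with `γ`, as each
term is killed separately. -/
theorem kernel_eq_zero_of_not_elliptic (hG : IsConnReductive G) {f : G.adelicOne → ℂ}
    (hreg : IsParabolicallyRegular f) {𝔬 : Set (GL (Fin n) ℚ)} (h𝔬 : ¬ IsEllipticClass G 𝔬)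
    {D : ParabolicDatum G} (hD : D.P = G) (ν : Measure (D.N.pts Adele))
    {x : GL (Fin n) Adele} (hx : x ∈ G.pts Adele) : kernel f 𝔬 D ν x x = 0 := by
  have h : ∀ (γ : {γ : GL (Fin n) ℚ // γ ∈ D.L.pts ℚ ∧ γ ∈ 𝔬}) (u : D.N.pts Adele),
      Function.extend Subtype.val f 0 (x⁻¹ * diag γ.1 * (u : GL (Fin n) Adele) * x) = 0 := by
    intro γ u
    have hγ : ¬ IsEllipticElt G γ.1 := fun h => h𝔬 ⟨γ.1, γ.2.2, h⟩
    simp only [IsEllipticElt, not_forall] at hγ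
    obtain ⟨P, hP, hγP, hPG⟩ := hγ
    rw [pts_eq_one_of_Qbar (N_Qbar_eq_bot hG hD) u.2]
    exact hreg.extend_eq_zero hP hPG hγP (one_mem _) (by simp) hx
  simp [kernel, h]

theorem IsSemisimplePart.conj {γ s : GL (Fin n) ℚ} (h : IsSemisimplePart γ s)
    (δ : GL (Fin n) ℚ) : IsSemisimplePart (δ * γ * δ⁻¹) (δ * s * δ⁻¹) := by
  obtain ⟨hs, hc, hn⟩ := h
  refine ⟨?_, ?_, ?_⟩
  · let e : (Fin n → ℚ) ≃ₗ[ℚ] (Fin n → ℚ) :=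
      Matrix.toLin'OfInv (M := ((δ⁻¹ : GL (Fin n) ℚ) : Matrix (Fin n) (Fin n) ℚ))
        (M' := (δ : Matrix (Fin n) (Fin n) ℚ)) (by simp) (by simp)
    refine (LinearEquiv.isSemisimple_iff _ _ e (LinearMap.ext fun v => ?_)).1 hs
    change (δ : Matrix (Fin n) (Fin n) ℚ).mulVec ((s : Matrix (Fin n) (Fin n) ℚ).mulVec v) =
      ((δ * s * δ⁻¹ : GL (Fin n) ℚ) : Matrix (Fin n) (Fin n) ℚ).mulVec
        ((δ : Matrix (Fin n) (Fin n) ℚ).mulVec v)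
    rw [Matrix.mulVec_mulVec, Matrix.mulVec_mulVec, ← Units.val_mul, ← Units.val_mul,
      inv_mul_cancel_right]
  · simp only [mul_assoc, inv_mul_cancel_left]
    rw [← mul_assoc s, hc, mul_assoc]
  · have h1 : (δ * s * δ⁻¹)⁻¹ * (δ * γ * δ⁻¹) = δ * (s⁻¹ * γ) * δ⁻¹ := by group
    obtain ⟨m, hm⟩ := hn
    refine ⟨m, ?_⟩
    have h2 : ((δ * (s⁻¹ * γ) * δ⁻¹ : GL (Fin n) ℚ) : Matrix (Fin n) (Fin n) ℚ) - 1 =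
        (δ : Matrix (Fin n) (Fin n) ℚ) *
          (((s⁻¹ * γ : GL (Fin n) ℚ) : Matrix (Fin n) (Fin n) ℚ) - 1) *
          ((δ⁻¹ : GL (Fin n) ℚ) : Matrix (Fin n) (Fin n) ℚ) := by
      rw [mul_sub, sub_mul, mul_one, Units.mul_inv]
      rfl
    rw [h1, h2, Units.conj_pow, hm, mul_zero, zero_mul]

theorem IsClass.conj_mem {𝔬 : Set (GL (Fin n) ℚ)} (h𝔬 : IsClass G 𝔬) {γ δ : GL (Fin n) ℚ}
    (hγ : γ ∈ 𝔬) (hδ : δ ∈ G.pts ℚ) : δ * γ * δ⁻¹ ∈ 𝔬 := by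
  obtain ⟨γ₀, -, rfl⟩ := h𝔬
  obtain ⟨hγG, s, s', hs, hs', g, hg, rfl⟩ := hγ
  refine ⟨mul_mem (mul_mem hδ hγG) (inv_mem hδ), _, _, hs.conj δ, hs', g * δ⁻¹,
    mul_mem hg (inv_mem hδ), ?_⟩
  group

/-- The kernel of `G` on the diagonal is invariant under `G(ℚ)`. -/
theorem kernel_diag_mul (hG : IsConnReductive G) (f : G.adelicOne → ℂ)
    {𝔬 : Set (GL (Fin n) ℚ)} (h𝔬 : IsClass G 𝔬) {D : ParabolicDatum G} (hD : D.P = G)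
    (ν : Measure (D.N.pts Adele)) (x : GL (Fin n) Adele) {δ : GL (Fin n) ℚ}
    (hδ : δ ∈ G.pts ℚ) :
    kernel f 𝔬 D ν (diag δ * x) (diag δ * x) = kernel f 𝔬 D ν x x := by
  have hL := L_eq hG hD
  have hδL : δ ∈ D.L.pts ℚ := hL.symm ▸ hδ
  have hu : ∀ u : D.N.pts Adele, (u : GL (Fin n) Adele) = 1 := fun u =>
    pts_eq_one_of_Qbar (N_Qbar_eq_bot hG hD) u.2
  -- Substituting `γ ↦ δγδ⁻¹` in the sum cancels `δ`, since `𝔬` is stable under conjugation.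
  let e : {γ : GL (Fin n) ℚ // γ ∈ D.L.pts ℚ ∧ γ ∈ 𝔬} ≃
      {γ : GL (Fin n) ℚ // γ ∈ D.L.pts ℚ ∧ γ ∈ 𝔬} :=
    { toFun := fun γ => ⟨δ * γ.1 * δ⁻¹,
        mul_mem (mul_mem hδL γ.2.1) (inv_mem hδL), h𝔬.conj_mem γ.2.2 hδ⟩
      invFun := fun γ => ⟨δ⁻¹ * γ.1 * δ,
        mul_mem (mul_mem (inv_mem hδL) γ.2.1) hδL,
        by simpa using h𝔬.conj_mem γ.2.2 (inv_mem hδ)⟩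
      left_inv := fun γ => Subtype.ext (by simp [mul_assoc])
      right_inv := fun γ => Subtype.ext (by simp [mul_assoc]) }
  rw [kernel, ← e.tsum_eq, kernel]
  refine tsum_congr fun γ => integral_congr_ae (Eventually.of_forall fun u => ?_)
  simp [hu, e, mul_assoc]

/-- For parabolically regular `f`, only `P = G` contributes to `k_𝔬`. -/
theorem kFun_eq_kernel (hG : IsConnReductive G) (D₀ : ParabolicDatum G)
    {DG : ParabolicDatum G} (hDG : DG.P = G) (K : Subgroup (GL (Fin n) Adele)) (T : D₀.aSpace)
    (ν : ∀ D : ParabolicDatum G, Measure (D.N.pts Adele)) {f : G.adelicOne → ℂ}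
    (hreg : IsParabolicallyRegular f) {𝔬 : Set (GL (Fin n) ℚ)} (h𝔬 : IsClass G 𝔬)
    {x : GL (Fin n) Adele} (hx : x ∈ G.pts Adele) :
    kFun D₀ DG K T ν f 𝔬 x = kernel f 𝔬 DG (ν DG) x x := by
  rw [kFun, finsum_eq_single _ ⟨DG, isStandard_of_P_eq hG D₀ hDG⟩]
  · have : Subsingleton (RatCosets DG) := by
      rw [RatCosets, hDG, Subgroup.subgroupOf_self]
      refine ⟨fun a b => ?_⟩
      induction a using Quotient.inductionOn
      induction b using Quotient.inductionOn
      exact Quotient.sound (QuotientGroup.rightRel_apply.2 (Subgroup.mem_top _))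
    let δ : RatCosets DG := Quotient.mk _ 1
    rw [Nat.sub_self, pow_zero, one_mul, tsum_eq_single δ fun b hb => absurd
      (Subsingleton.elim b δ) hb, tauHat_of_P_eq hG D₀ hDG, mul_one]
    -- The chosen representative of the only coset need not be `1`, so invariance under `G(ℚ)` is
    -- needed.
    exact kernel_diag_mul hG f h𝔬 hDG (ν DG) x δ.out.2
  · intro D hD
    -- The sum runs over data rather than subgroups; uniqueness of the datum of `G` makes every
    -- other term proper.
    have hP : D.1.P ≠ G := fun h => hD (Subtype.ext (eq_of_P_eq hG h hDG))
    have h : ∀ δ : RatCosets D.1,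
        kernel f 𝔬 D.1 (ν D.1) (diag δ.out.1 * x) (diag δ.out.1 * x) = 0 := fun δ =>
      kernel_eq_zero hreg 𝔬 hP _ (mul_mem (diag_mem_pts δ.out.2) hx)
    simp [h]

end KernelFormulas

end SimpleTrace

open SimpleTrace
theorem mainTheorem5 {n : ℕ} (G : QGroup n) (hG : IsConnReductive G)
    (D₀ DG : ParabolicDatum G) (hD₀ : D₀.IsMinimal) (hDG : DG.P = G)
    (K : Subgroup (GL (Fin n) Adele)) (hKG : K ≤ G.pts Adele)
    (hKc : IsCompact (K : Set (GL (Fin n) Adele))) (hK : D₀.HasIwasawa K)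
    (T : D₀.aSpace)
    (ν : ∀ D : ParabolicDatum G, Measure (D.N.pts Adele)) (hν : ∀ D, (ν D).IsHaarMeasure)
    (μ : Measure G.adelicOne) (hμ : μ.IsHaarMeasure)
    (F : Set G.adelicOne) (hF : IsFundamentalDomain (ratSubgroup G) F μ)
    (f : G.adelicOne → ℂ) (hf : IsTestFunction f) (hreg : IsParabolicallyRegular f)
    (𝔬 : Set (GL (Fin n) ℚ)) (h𝔬 : IsClass G 𝔬) :
    (¬ IsEllipticClass G 𝔬 →
      IntegrableOn (fun x : G.adelicOne => kFun D₀ DG K T ν f 𝔬 x) F μ ∧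
      geomTerm D₀ DG K T ν μ F f 𝔬 = 0) ∧
    (IsEllipticClass G 𝔬 →
      (IntegrableOn (fun x : G.adelicOne => kFun D₀ DG K T ν f 𝔬 x) F μ ↔
        IntegrableOn (fun x : G.adelicOne => kernel f 𝔬 DG (ν DG) x x) F μ) ∧
      geomTerm D₀ DG K T ν μ F f 𝔬 = ∫ x in F, kernel f 𝔬 DG (ν DG) x x ∂μ) := by
  -- The integrands agree at every point, so the elliptic case is immediate.
  have key : (fun x : G.adelicOne => kFun D₀ DG K T ν f 𝔬 x) =
      fun x : G.adelicOne => kernel f 𝔬 DG (ν DG) x x := funext fun x =>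
    kFun_eq_kernel hG D₀ hDG K T ν hreg h𝔬 (mem_pts_of_adelicOne x)
  rw [geomTerm, key]
  refine ⟨fun hell => ?_, fun _ => ⟨Iff.rfl, rfl⟩⟩
  have h0 : ∀ x : G.adelicOne, kernel f 𝔬 DG (ν DG) x x = 0 := fun x =>
    kernel_eq_zero_of_not_elliptic hG hreg hell hDG (ν DG) (mem_pts_of_adelicOne x)
  simp [h0]
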